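/- Let $G=(V,E)$ be a finite tree with at least two vertices, let $D(G)\ge 1$ be its diameter, and let $n,f$ be natural numbers with $n>3f$. Model (Byzantine asynchronous rounds). There is a set $P$ of $n$ processors; an unknown set $F\subseteq P$ with $|F|\le f$ is Byzantine, the others are correct. In every round $t=0,1,2,\dots$ each correct processor broadcasts a message determined by its local state, receives from each $j\in P$ a message or nothing ($M_{ij}(t)\neq\bot$ or $M_{ij}(t)=\bot$), and updates its state deterministically. A message received from a correct processor is the one it sent; messages from processors in $F$ are arbitrary. Otherwise the adversary chooses which messages arrive, subject to: with $P_i(t)=\{j: M_{ij}(t)\ne\bot\}$, for all correct $i,j$ one has $|P_i(t)|\ge n-f$ and $|P_i(t)\cap P_j(t)|\ge n-f$; and if $k\in F$ and $M_{ik}(t)=x\ne\bot$, then $M_{jk}(t)\in\{x,\bot\}$. Task. Processor $i$ has an input $x_i\in V$. An algorithm solves approximate agreement on $G$ in $T$ rounds if in every execution the outputs $y_i$ of the correct processors after $T$ rounds satisfy $d_G(y_i,y_j)\le 1$ for all correct $i,j$ (agreement) and $y_i\in\langle\{x_j : j\in P\setminus F\}\rangle$ for all correct $i$ (validity). Here $\langle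 A\rangle$ is the smallest superset of $A\subseteq V$ that contains all vertices of every chordless path between two of its members. Theorem. Approximate agreement on $G$ is solvable in $\lfloor\log_2 D(G)\rfloor+1\le\log_2 D(G)+1$ rounds. More precisely, $G$ has a perfect elimination ordering, that is, a total order $\preceq$ on $V$ such that for each $u\in V$ the neighbours $v$ of $u$ with $u\preceq v$ form a clique. For every such order and every integer $T\ge\lfloor\log_2 D(G)\rfloor+1$ (in particular for $T=\lceil\log_2 D(G)\rceil+1$), approximate agreement on $G$ is solved in $T$ rounds by the following algorithm. In every round each correct processor $i$ broadcasts its current value (initially $x_i$), computes the safe area $$H_i=\bigcap\big\{\langle\{M_{ij}(t): j\in J\}\rangle : J\subseteq P_i(t),\ |J|=|P_i(t)|-f\big\},$$ and takes as its new value the $\preceq$-largest vertex of the center of the induced subgraph $G[H_i]$; after $T$ rounds it outputs its current value. -/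

import Mathlib

universe u v

namespace ByzantineAgreement

/-! ### Chordless-path convexity of a graph -/

section Convexity

variable {V : Type u} (G : SimpleGraph V)

/-- A set of vertices is (monophonically) convex if it contains all vertices of all chordless paths
between any two of its members. -/
def IsMonoConvex (U : Set V) : Prop :=
  ∀ a ∈ U, ∀ b ∈ U, ∀ p : G.Walk a b, p.IsPath → p.IsChordless → ∀ w ∈ p.support, w ∈ U

/-- The convex hull of `A`: the least convex set containing `A`. -/
def monoHull (A : Set V) : Set V :=
  ⋂₀ {U : Set V | IsMonoConvex G U ∧ A ⊆ U}

theorem subset_monoHull (A : Set V) : A ⊆ monoHull G A :=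
  Set.subset_sInter fun _ hU => hU.2

theorem isMonoConvex_monoHull (A : Set V) : IsMonoConvex G (monoHull G A) :=
  fun a ha b hb p hp hc w hw U hU => hU.1 a (ha U hU) b (hb U hU) p hp hc w hw

/-- The center of the subgraph of `G` induced by `K`, as a set of vertices of `G`. -/
def centerOf (K : Set V) : Set V :=
  Subtype.val '' (G.induce K).center

/-- A total order on the vertices is a perfect elimination ordering if every vertex `a` is
simplicial in the set of all vertices that are at least `a`: its neighbours there form a clique. -/
def IsPerfectEliminationOrder [LinearOrder V] : Prop :=
  ∀ a : V, G.IsClique (G.neighborSet a ∩ {b | a ≤ b})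

end Convexity

/-! ### The Byzantine asynchronous round model -/

/-- A deterministic algorithm for the asynchronous round model with processors `P` and
input/output values `V`. In round `t` a correct processor broadcasts a message that depends on its
identity, on `t` and on its local state; from the messages it receives (`none` stands for the empty
message) it computes its next state. `decide` reads off the output from a state. -/
structure RoundAlgorithm (P : Type v) (V : Type u) where
  State : Type u
  Msg : Type u
  init : P → V → State
  send : P → ℕ → State → Msg
  update : P → ℕ → State → (P → Option Msg) → State
  decide : P → State → V

namespace RoundAlgorithm

variable {P : Type v} {V : Type u} (A : RoundAlgorithm P V)

/-- The state of each processor at the start of round `t` if the inputs are `x` and `M t i j` is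
what `i` receives from `j` in round `t`. (Only the values at correct processors are meaningful.) -/
def state (x : P → V) (M : ℕ → P → P → Option A.Msg) : ℕ → P → A.State
  | 0, i => A.init i (x i)
  | t + 1, i => A.update i t (state x M t i) (M t i)

/-- `M` is a possible pattern of received messages in the Byzantine asynchronous round model with
fault bound `f`, set `F` of faulty processors and inputs `x`. -/
structure IsExecution [Fintype P] (f : ℕ) (F : Finset P) (x : P → V)
    (M : ℕ → P → P → Option A.Msg) : Prop where
  /-- At most `f` processors are faulty. -/
  card_faulty_le : F.card ≤ f
  /-- What arrives from a correct processor is what that processor sent. -/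
  correct_sender : ∀ t, ∀ i ∉ F, ∀ j ∉ F, ∀ m,
    M t i j = some m → m = A.send j t (A.state x M t j)
  /-- Each correct processor receives at least `n - f` messages in each round. -/
  quorum : ∀ t, ∀ i ∉ F,
    Fintype.card P - f ≤ (Finset.univ.filter fun k => (M t i k).isSome).card
  /-- Any two correct processors receive messages from at least `n - f` common processors. -/
  common : ∀ t, ∀ i ∉ F, ∀ j ∉ F,
    Fintype.card P - f ≤
      (Finset.univ.filter fun k => (M t i k).isSome ∧ (M t j k).isSome).card
  /-- A faulty processor may send anything, but no two different messages in a round. -/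
  consistent : ∀ t, ∀ i ∉ F, ∀ j ∉ F, ∀ k ∈ F, ∀ m m',
    M t i k = some m → M t j k = some m' → m = m'

/-- `A` solves approximate agreement on `G` in `T` asynchronous rounds, in spite of up to `f`
Byzantine processors: in every execution, the outputs after `T` rounds (rounds `0, …, T - 1`) of the
correct processors lie in the convex hull of the inputs of the correct processors and are pairwise
at distance at most one. -/
def SolvesApproxAgreement [Fintype P] (G : SimpleGraph V) (f T : ℕ) : Prop :=
  ∀ (F : Finset P) (x : P → V) (M : ℕ → P → P → Option A.Msg), A.IsExecution f F x M →
    (∀ i ∉ F, A.decide i (A.state x M T i) ∈ monoHull G (x '' {j | j ∉ F})) ∧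
    (∀ i ∉ F, ∀ j ∉ F,
      G.dist (A.decide i (A.state x M T i)) (A.decide j (A.state x M T j)) ≤ 1)

end RoundAlgorithm

/-! ### The safe-area algorithm on trees -/

section SafeArea

variable {P : Type v} [Fintype P] {V : Type u}

/-- The processors from which a nonempty message was received. -/
def received (m : P → Option V) : Finset P :=
  Finset.univ.filter fun j => (m j).isSome

/-- The values received from the processors in `J`. -/
def valuesOf (m : P → Option V) (J : Finset P) : Set V :=
  {a | ∃ j ∈ J, m j = some a}

/-- The safe area: the intersection of the hulls of the values received from `J`, over all sets `J`
of all but `f` of the processors from which a value was received. -/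
def safeArea (G : SimpleGraph V) (f : ℕ) (m : P → Option V) : Set V :=
  ⋂ J ∈ (received m).powersetCard ((received m).card - f), monoHull G (valuesOf m J)

open Classical in
/-- The greatest central vertex of `K`. If there is none (for a finite graph: if `K` is empty) the
value is the default `a`. -/
noncomputable def maxCenter [LinearOrder V] (G : SimpleGraph V) (a : V) (K : Set V) : V :=
  if h : ∃ c, IsGreatest (centerOf G K) c then h.choose else a

/-- In every round each processor broadcasts its current value and replaces it by the greatest
central vertex of its safe area (with an empty safe area it would keep its value). The output is
the current value. -/
noncomputable def safeAreaAlgorithm (P : Type v) [Fintype P] {V : Type u} [LinearOrder V]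
    (G : SimpleGraph V) (f : ℕ) : RoundAlgorithm P V where
  State := V
  Msg := V
  init _ a := a
  send _ _ a := a
  update _ _ a m := maxCenter G a (safeArea G f m)
  decide _ a := a

end SafeArea

end ByzantineAgreement

/-!
One round of the safe-area algorithm on a tree roughly halves the diameter of the set of values held
by the correct processors, while keeping these values in their hull.

The basic fact about trees is `dist_eq_of_separated`: every edge separates the vertices nearer to
one end from those nearer to the other. It makes convexity a metric notion
(`isMonoConvex_iff_dist`), shows that taking hulls does not increase diameters
(`dist_le_of_mem_monoHull`), and gives the Helly property (`exists_mem_of_pairwise_inter`). As any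
two correct processors have at least `n - f > 2 * f` received messages in common, the hulls defining
their two safe areas meet pairwise, so by Helly the two safe areas intersect
(`safeArea_inter_nonempty`). Each safe area lies in the hull of the values of the correct
processors (`safeArea_subset_monoHull`), which is validity.

For the contraction (`two_mul_dist_le_of_isGreatest_centerOf`), let `c` and `q` be the greatest
central vertices of two intersecting convex sets `U` and `W`. Behind `c`, as seen from `q`, there is
a vertex of `U` at distance `s` from `c`, where `s` is at least the radius of `U` minus an error `k`
equal to `0` or `1`; the error is `0` if the path from `c` to `q` starts with an ascent in the
elimination ordering (`exists_far_of_isGreatest_centerOf`). The same holds for `q` with some `s'`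
and `k'`. A path in a tree cannot have an interior vertex both of whose neighbours on the path are
greater, so it ascends from at least one of its two ends, whence `k + k' ≤ 1`. Now
`dist c q + s + s'` is at most the diameter `d` of the hull, and `dist c q ≤ s + s' + k + k'`
because `U` and `W` intersect; together these give `2 * dist c q ≤ d + 1`. Iterating
`d ↦ (d + 1) / 2` from the diameter `D` of the tree gives a value of at most `1` after `T` rounds
whenever `D < 2 ^ T`.
-/

namespace ByzantineAgreement

open SimpleGraph

/-! ### Distances in a tree -/

section TreeMetric

variable {V : Type u} {G : SimpleGraph V}

theorem eq_of_isPath (hG : G.IsTree) {a b : V} {p q : G.Walk a b} (hp : p.IsPath)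
    (hq : q.IsPath) : p = q :=
  (hG.existsUnique_path a b).unique hp hq

theorem length_eq_dist_of_isPath (hG : G.IsTree) {a b : V} {p : G.Walk a b} (hp : p.IsPath) :
    p.length = G.dist a b := by
  obtain ⟨q, hq, hl⟩ := hG.connected.exists_path_of_dist a b
  rw [← hl, eq_of_isPath hG hp hq]

theorem dist_add_dist_of_mem_support (hG : G.IsTree) {a b w : V} {p : G.Walk a b}
    (hp : p.IsPath) (hw : w ∈ p.support) : G.dist a w + G.dist w b = G.dist a b := by
  classical
  rw [← length_eq_dist_of_isPath hG hp, ← length_eq_dist_of_isPath hG (hp.takeUntil hw),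
    ← length_eq_dist_of_isPath hG (hp.dropUntil hw), ← Walk.length_append, Walk.take_spec]

theorem isChordless_of_isPath (hG : G.IsTree) {a b : V} {p : G.Walk a b} (hp : p.IsPath) :
    p.IsChordless := by
  classical
  rw [Walk.isChordless_iff_forall_mem_edges]
  -- an edge between vertices of `p` is the only path between its ends, so it is a part of `p`
  have key : ∀ {c d : V} (q : G.Walk c d), q.IsPath → G.Adj c d → s(c, d) ∈ q.edges := by
    intro c d q hq h
    have hh : h.toWalk.IsPath := by simp [h.ne]
    rw [eq_of_isPath hG hq hh]
    simp
  intro c d hc hd h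
  rw [← Walk.take_spec p hc, Walk.mem_support_append_iff] at hd
  rcases hd with hd | hd
  · rw [Sym2.eq_swap]
    exact p.edges_takeUntil_subset_edges hc (Walk.edges_dropUntil_subset_edges _ hd
      (key _ ((hp.takeUntil hc).dropUntil hd) h.symm))
  · exact p.edges_dropUntil_subset_edges hc (Walk.edges_takeUntil_subset_edges _ hd
      (key _ ((hp.dropUntil hc).takeUntil hd) h))

theorem exists_adj_dist_eq (hG : G.IsTree) {c x : V} (h : c ≠ x) :
    ∃ a, G.Adj c a ∧ G.dist c x = G.dist a x + 1 := by
  obtain ⟨p, hp, hl⟩ := hG.connected.exists_path_of_dist c x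
  cases p with
  | nil => exact absurd rfl h
  | cons hadj q =>
    refine ⟨_, hadj, ?_⟩
    rw [← hl, Walk.length_cons, length_eq_dist_of_isPath hG (Walk.IsPath.of_cons hp)]

/-- Every edge of a tree separates the vertices nearer to one end from those nearer to the other:
a path between the two sides crosses the edge. -/
theorem dist_eq_of_separated (hG : G.IsTree) {c a u x : V} (hca : G.Adj c a)
    (hu : G.dist u a = G.dist u c + 1) (hx : G.dist x c = G.dist x a + 1) :
    G.dist u x = G.dist u c + 1 + G.dist a x := by
  obtain ⟨p, hp, hpl⟩ := hG.connected.exists_path_of_dist u c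
  obtain ⟨q, hq, hql⟩ := hG.connected.exists_path_of_dist a x
  have hpath : (p.append (Walk.cons hca q)).IsPath := by
    rw [Walk.isPath_def, Walk.support_append, Walk.support_cons, List.tail_cons,
      List.nodup_append']
    refine ⟨hp.support_nodup, hq.support_nodup, fun w hwp hwq => ?_⟩
    -- a common vertex would be nearer to `c` than to `a` and also nearer to `a` than to `c`
    have h1 := dist_add_dist_of_mem_support hG hp hwp
    have h2 := dist_add_dist_of_mem_support hG hq hwq
    have h3 := hG.connected.dist_triangle (u := u) (v := w) (w := a)
    have h4 := hG.connected.dist_triangle (u := x) (v := w) (w := c)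
    rw [G.dist_comm (u := a) (v := w), G.dist_comm (u := w) (v := x)] at h2
    rw [G.dist_comm (u := a) (v := x)] at h2
    omega
  rw [← length_eq_dist_of_isPath hG hpath, Walk.length_append, Walk.length_cons, hpl, hql]
  omega

/-- Balls of a tree are convex. -/
theorem dist_le_of_between (hG : G.IsTree) {a b w z : V} {r : ℕ}
    (hw : G.dist a w + G.dist w b = G.dist a b) (ha : G.dist a z ≤ r) (hb : G.dist b z ≤ r) :
    G.dist w z ≤ r := by
  rcases eq_or_ne w b with rfl | hne
  · exact hb
  obtain ⟨c, hc, hcb⟩ := exists_adj_dist_eq hG hne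
  have hac : G.dist a c = G.dist a w + 1 := by
    have := hG.connected.dist_triangle (u := a) (v := c) (w := b)
    rcases hG.dist_eq_dist_add_one_of_adj a hc with h | h <;> omega
  rcases hG.dist_eq_dist_add_one_of_adj z hc with h | h
  · have := dist_eq_of_separated hG hc hac h
    rw [G.dist_comm (u := w)]
    rw [G.dist_comm (u := c)] at this
    omega
  · have hbw : G.dist b w = G.dist b c + 1 := by
      rw [G.dist_comm (u := b), G.dist_comm (u := b), hcb]
    have := dist_eq_of_separated hG hc h hbw
    rw [G.dist_comm (u := w)]
    rw [G.dist_comm (u := b)] at hb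
    omega

end TreeMetric

/-! ### Convex sets of a tree -/

section TreeConvexity

variable {V : Type u} {G : SimpleGraph V}

/-- In a tree, convexity is a metric notion, since all paths are chordless and shortest. -/
theorem isMonoConvex_iff_dist (hG : G.IsTree) {U : Set V} :
    IsMonoConvex G U ↔
      ∀ a ∈ U, ∀ b ∈ U, ∀ w, G.dist a w + G.dist w b = G.dist a b → w ∈ U := by
  constructor
  · intro h a ha b hb w hw
    obtain ⟨p, hp⟩ := hG.connected.exists_walk_length_eq_dist a w
    obtain ⟨q, hq⟩ := hG.connected.exists_walk_length_eq_dist w b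
    have hpath : (p.append q).IsPath := by
      apply Walk.isPath_of_length_eq_dist
      rw [Walk.length_append, hp, hq, hw]
    exact h a ha b hb _ hpath (isChordless_of_isPath hG hpath) w
      ((Walk.mem_support_append_iff ..).2 (Or.inl p.end_mem_support))
  · intro h a ha b hb p hp _ w hw
    exact h a ha b hb w (dist_add_dist_of_mem_support hG hp hw)

theorem monoHull_subset {A U : Set V} (hU : IsMonoConvex G U) (h : A ⊆ U) : monoHull G A ⊆ U :=
  Set.sInter_subset_of_mem ⟨hU, h⟩

/-- Taking the hull does not increase the diameter. -/
theorem dist_le_of_mem_monoHull (hG : G.IsTree) {A : Set V} {r : ℕ}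
    (h : ∀ a ∈ A, ∀ b ∈ A, G.dist a b ≤ r) :
    ∀ a ∈ monoHull G A, ∀ b ∈ monoHull G A, G.dist a b ≤ r := by
  have ball : ∀ z, IsMonoConvex G {w | G.dist w z ≤ r} := fun z =>
    (isMonoConvex_iff_dist hG).2 fun a ha b hb w hw => dist_le_of_between hG hw ha hb
  have h1 : ∀ z ∈ A, ∀ w ∈ monoHull G A, G.dist w z ≤ r := fun z hz =>
    monoHull_subset (ball z) fun a ha => h a ha z hz
  intro a ha b hb
  refine monoHull_subset (ball b) (fun c hc => ?_) ha
  rw [Set.mem_ofPred_eq, G.dist_comm]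
  exact h1 c hc b hb

/-- The vertex `g` of a convex set nearest to `z` is a gate: a shortest path from `z` to any vertex
of the set passes through `g`. -/
theorem exists_gate (hG : G.IsTree) {U : Set V} (hU : IsMonoConvex G U) (hne : U.Nonempty)
    (z : V) : ∃ g ∈ U, ∀ x ∈ U, G.dist z x = G.dist z g + G.dist g x := by
  obtain ⟨g, hg, hmin⟩ := exists_minimalFor_of_wellFoundedLT (· ∈ U) (G.dist z) hne
  refine ⟨g, hg, fun x hx => ?_⟩
  rcases eq_or_ne g x with rfl | hgx
  · simp
  obtain ⟨a, ha, hax⟩ := exists_adj_dist_eq hG hgx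
  have haU : a ∈ U := (isMonoConvex_iff_dist hG).1 hU g hg x hx a <| by
    rw [dist_eq_one_iff_adj.2 ha]; omega
  have hza : G.dist z a = G.dist z g + 1 := by
    rcases hG.dist_eq_dist_add_one_of_adj z ha with h | h
    · have := hmin haU (by omega)
      omega
    · exact h
  have := dist_eq_of_separated hG ha hza (x := x) (by rw [G.dist_comm, hax, G.dist_comm])
  omega

/-- The Helly property of subtrees. The gate farthest from a fixed vertex lies in all the sets. -/
theorem exists_mem_of_pairwise_inter (hG : G.IsTree) [Finite V] {S : Set (Set V)}
    (hS : ∀ U ∈ S, IsMonoConvex G U) (hne : ∀ U ∈ S, ∀ W ∈ S, (U ∩ W).Nonempty) :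
    ∃ g, ∀ U ∈ S, g ∈ U := by
  obtain ⟨z⟩ := hG.connected.nonempty
  rcases S.eq_empty_or_nonempty with rfl | hSne
  · exact ⟨z, by simp⟩
  have hgate : ∀ U : Set V, ∃ g, U ∈ S →
      g ∈ U ∧ ∀ x ∈ U, G.dist z x = G.dist z g + G.dist g x := by
    intro U
    by_cases hU : U ∈ S
    · obtain ⟨g, hg⟩ := exists_gate hG (hS U hU) ((hne U hU U hU).mono Set.inter_subset_left) z
      exact ⟨g, fun _ => hg⟩
    · exact ⟨z, fun h => absurd h hU⟩
  choose g hg using hgate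
  obtain ⟨U, hU, hmax⟩ := Set.exists_max_image S (fun U => G.dist z (g U)) S.toFinite hSne
  refine ⟨g U, fun W hW => ?_⟩
  obtain ⟨x, hxU, hxW⟩ := hne U hU W hW
  rcases eq_or_ne (g U) x with h | hgx
  · rwa [h]
  have h1 := (hg U hU).2 x hxU
  have h2 := (hg W hW).2 x hxW
  have h3 := hmax W hW
  -- `g U` lies between `g W` and `x`: look at the edge from `g U` towards `x`
  obtain ⟨a, ha, hax⟩ := exists_adj_dist_eq hG hgx
  have hza : G.dist z a = G.dist z (g U) + 1 := by
    have := hG.connected.dist_triangle (u := z) (v := a) (w := x)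
    rcases hG.dist_eq_dist_add_one_of_adj z ha with h | h <;> omega
  have hxa : G.dist x (g U) = G.dist x a + 1 := by rw [G.dist_comm, hax, G.dist_comm]
  have hga : G.dist (g W) a = G.dist (g W) (g U) + 1 := by
    rcases hG.dist_eq_dist_add_one_of_adj (g W) ha with h | h
    · have := dist_eq_of_separated hG ha hza h
      omega
    · exact h
  have h4 := dist_eq_of_separated hG ha hga hxa
  exact (isMonoConvex_iff_dist hG).1 (hS W hW) _ (hg W hW).1 x hxW _ (by omega)

end TreeConvexity

/-! ### Centers of convex sets -/

section Center

variable {V : Type u} {G : SimpleGraph V}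

theorem edist_induce_eq (hG : G.IsTree) {U : Set V} (hU : IsMonoConvex G U) (a b : U) :
    (G.induce U).edist a b = G.dist a b := by
  apply le_antisymm
  · obtain ⟨p, hp, hl⟩ := hG.connected.exists_path_of_dist (a : V) b
    have hs : ∀ w ∈ p.support, w ∈ U :=
      hU a a.2 b b.2 p hp (isChordless_of_isPath hG hp)
    rw [← hl]
    refine (edist_le (p.induce U hs)).trans_eq ?_
    rw [← Walk.length_map (Embedding.induce U).toHom, Walk.map_induce]
    rfl
  · rw [edist_eq_sInf]
    refine le_sInf ?_
    rintro _ ⟨p, rfl⟩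
    dsimp only
    rw [← Walk.length_map (Embedding.induce U).toHom]
    exact_mod_cast G.dist_le (p.map (Embedding.induce U).toHom)

theorem eccent_induce_le_iff (hG : G.IsTree) {U : Set V} (hU : IsMonoConvex G U) {a : V}
    (ha : a ∈ U) (r : ℕ) : (G.induce U).eccent ⟨a, ha⟩ ≤ r ↔ ∀ w ∈ U, G.dist a w ≤ r := by
  simp [eccent_le_iff, edist_induce_eq hG hU]

theorem exists_isGreatest_centerOf [Finite V] [LinearOrder V] {U : Set V} (hne : U.Nonempty) :
    ∃ c, IsGreatest (centerOf G U) c := by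
  have := hne.to_subtype
  have : (centerOf G U).Nonempty := center_nonempty.image _
  obtain ⟨c, hc, hmax⟩ := Set.exists_max_image _ id (Set.toFinite _) this
  exact ⟨c, hc, hmax⟩

/-- Look from the greatest central vertex `c` of a convex set `U` in the direction of a neighbour
`a`. In the other directions there is a vertex `u` of `U` that is as far from `c` as any vertex of
`U` up to an error `k`, which can be taken to be `1`, and even `0` if `c < a`.
Otherwise `a` would be a vertex of `U` of smaller eccentricity than `c`, or another central vertex
that is greater. -/
theorem exists_far_of_isGreatest_centerOf (hG : G.IsTree) [Finite V] [LinearOrder V] {U : Set V}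
    (hU : IsMonoConvex G U) {c a : V} (hc : IsGreatest (centerOf G U) c) (ha : G.Adj c a)
    {k : ℕ} (hk : k = 0 ∧ c < a ∨ k = 1) :
    ∃ u ∈ U, G.dist u a = G.dist u c + 1 ∧ ∀ w ∈ U, G.dist c w ≤ G.dist u c + k := by
  obtain ⟨⟨c, hcU⟩, hcc, rfl⟩ := hc.1
  dsimp only at *
  obtain ⟨w, hw, hwmax⟩ := Set.exists_max_image U (fun w => G.dist c w) U.toFinite ⟨c, hcU⟩
  by_contra! hcon
  -- all vertices of `U` on the side of `c` are at distance less than `dist c w - k` from `c`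
  have hside : ∀ u ∈ U, G.dist u a = G.dist u c + 1 → G.dist u c + k < G.dist c w := by
    intro u hu hua
    obtain ⟨w', hw', h⟩ := hcon u hu hua
    exact h.trans_le (hwmax w' hw')
  have hcw : G.dist w c = G.dist w a + 1 := by
    rcases hG.dist_eq_dist_add_one_of_adj w ha with h | h
    · exact h
    · have := hside w hw h
      rw [G.dist_comm] at this
      omega
  have haU : a ∈ U := (isMonoConvex_iff_dist hG).1 hU c hcU w hw a <| by
    rw [dist_eq_one_iff_adj.2 ha, G.dist_comm (u := a), G.dist_comm (u := c)]; omega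
  have hecc : ∀ r : ℕ, G.dist c w ≤ r + k → (G.induce U).eccent ⟨a, haU⟩ ≤ r := by
    intro r hr
    rw [eccent_induce_le_iff hG hU]
    intro u hu
    rw [G.dist_comm]
    have h1 := hwmax u hu
    rw [G.dist_comm] at h1
    rcases hG.dist_eq_dist_add_one_of_adj u ha with h | h
    · omega
    · have := hside u hu h
      omega
  have hrad : ∀ r : ℕ, (G.induce U).eccent ⟨a, haU⟩ ≤ r → G.dist c w ≤ r := by
    intro r hr
    refine (eccent_induce_le_iff hG hU hcU r).1 (le_trans ?_ hr) w hw
    rw [(mem_center_iff _).1 hcc]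
    exact radius_le_eccent
  rcases hk with ⟨rfl, hlt⟩ | rfl
  · refine hlt.not_ge (hc.2 ⟨⟨a, haU⟩, ?_, rfl⟩)
    rw [mem_center_iff]
    refine le_antisymm ?_ radius_le_eccent
    rw [← (mem_center_iff _).1 hcc]
    refine (hecc _ le_rfl).trans ?_
    have := (G.induce U).edist_le_eccent (u := ⟨c, hcU⟩) (v := ⟨w, hw⟩)
    rwa [edist_induce_eq hG hU] at this
  · have h0 : G.dist c w ≠ 0 := by rw [G.dist_comm]; omega
    have := hrad _ (hecc (G.dist c w - 1) (by omega))
    omega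

end Center

/-! ### Perfect elimination orderings of a tree -/

section EliminationOrder

variable {V : Type u} {G : SimpleGraph V}

theorem IsPerfectEliminationOrder.eq_of_adj_of_le (hG : G.IsTree) [LinearOrder V]
    (hP : IsPerfectEliminationOrder G) {y a b : V} (ha : G.Adj y a) (hb : G.Adj y b)
    (hya : y ≤ a) (hyb : y ≤ b) : a = b := by
  by_contra hab
  have h : G.Adj a b := hP y ⟨ha, hya⟩ ⟨hb, hyb⟩ hab
  refine hG.dist_ne_of_adj y h ?_
  rw [dist_eq_one_iff_adj.2 ha, dist_eq_one_iff_adj.2 hb]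

/-- A path that starts with a descent keeps descending: its least vertex cannot have two greater
neighbours. Here `a` and `b` are the second and the last but one vertex of the path from `c` to
`q`. -/
theorem IsPerfectEliminationOrder.lt_of_path (hG : G.IsTree) [LinearOrder V]
    (hP : IsPerfectEliminationOrder G) {c q a b : V} (ha : G.Adj c a) (hb : G.Adj q b)
    (hca : G.dist c q = G.dist a q + 1) (hqb : G.dist q c = G.dist b c + 1) (hac : a < c) :
    q < b := by
  induction hn : G.dist a q generalizing c a with
  | zero =>
    have haq : a = q := hG.connected.dist_eq_zero_iff.1 hn
    subst haq
    have hbc : b = c := hG.connected.dist_eq_zero_iff.1 (by rw [G.dist_comm] at hqb; omega)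
    exact hbc ▸ hac
  | succ n ih =>
    have hne : a ≠ q := by rintro rfl; simp at hn
    obtain ⟨a', ha', haq⟩ := exists_adj_dist_eq hG hne
    refine ih (c := a) (a := a') ha' haq ?_ ?_ (by omega)
    · have hcq : G.dist c q = G.dist q c := G.dist_comm
      have hac' : G.dist a c = 1 := dist_eq_one_iff_adj.2 ha.symm
      have hba : G.dist b a = G.dist a b := G.dist_comm
      have hqa : G.dist q a = G.dist a q := G.dist_comm
      have hcb : G.dist c b = G.dist b c := G.dist_comm
      rcases hG.dist_eq_dist_add_one_of_adj a hb with h | h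
      · omega
      · have := dist_eq_of_separated hG hb h (x := c) (by omega)
        omega
    · by_contra hle
      have := hP.eq_of_adj_of_le hG ha.symm ha' hac.le (not_lt.1 hle)
      subst this
      omega

/-- Ordering the vertices by decreasing distance from a root gives a perfect elimination
ordering: the only neighbour that does not precede a vertex is its parent. -/
theorem exists_isPerfectEliminationOrder (hG : G.IsTree) [Finite V] :
    ∃ _ : LinearOrder V, IsPerfectEliminationOrder G := by
  obtain ⟨r⟩ := hG.connected.nonempty
  obtain ⟨n, ⟨e⟩⟩ := Finite.exists_equiv_fin V
  -- the index in the second component only breaks ties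
  let key : V → ℕᵒᵈ ×ₗ Fin n := fun v => toLex (OrderDual.toDual (G.dist r v), e v)
  have hkey : Function.Injective key := fun a b h => e.injective (congrArg Prod.snd h)
  refine ⟨LinearOrder.lift' key hkey, ?_⟩
  rintro y a ⟨ha, hya⟩ b ⟨hb, hyb⟩ hab
  exfalso
  have hle : ∀ x, key y ≤ key x → G.dist r x ≤ G.dist r y := by
    intro x hx
    rcases Prod.Lex.le_iff.1 hx with h | h
    · exact le_of_lt h
    · exact le_of_eq (congrArg OrderDual.ofDual h.1).symm
  have parent : ∀ x, G.Adj y x → key y ≤ key x → G.dist r y = G.dist r x + 1 := by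
    intro x hx h
    have := hle x h
    rcases hG.dist_eq_dist_add_one_of_adj r hx with h | h <;> omega
  have h1 := parent a ha hya
  have h2 := parent b hb hyb
  have hyb1 : G.dist b y = 1 := dist_eq_one_iff_adj.2 hb.symm
  have hba : G.dist b a = G.dist b y + 1 := by
    rcases hG.dist_eq_dist_add_one_of_adj b ha with h | h
    · exact absurd (hG.connected.dist_eq_zero_iff.1 (by omega)) (Ne.symm hab)
    · exact h
  have := dist_eq_of_separated hG ha.symm (u := r) (x := b) h1 hba
  rw [G.dist_comm (u := y)] at this
  omega

/-- If the vertices of one convex set are at distance at most `d` from those of another and the two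
sets intersect, then their greatest central vertices are at distance at most `(d + 1) / 2`. -/
theorem two_mul_dist_le_of_isGreatest_centerOf (hG : G.IsTree) [Finite V] [LinearOrder V]
    (hP : IsPerfectEliminationOrder G) {U W : Set V} (hU : IsMonoConvex G U)
    (hW : IsMonoConvex G W) (hUW : (U ∩ W).Nonempty) {d : ℕ}
    (hd : ∀ a ∈ U, ∀ b ∈ W, G.dist a b ≤ d) {c q : V}
    (hc : IsGreatest (centerOf G U) c) (hq : IsGreatest (centerOf G W) q) :
    2 * G.dist c q ≤ d + 1 := by
  rcases eq_or_ne c q with rfl | hcq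
  · simp
  obtain ⟨a, ha, hca⟩ := exists_adj_dist_eq hG hcq
  obtain ⟨b, hb, hqb⟩ := exists_adj_dist_eq hG hcq.symm
  -- the path from `c` to `q` ascends at one of its two ends, so the errors add up to at most `1`
  obtain ⟨k, l, hkl, hk, hl⟩ : ∃ k l : ℕ, k + l ≤ 1 ∧ (k = 0 ∧ c < a ∨ k = 1) ∧
      (l = 0 ∧ q < b ∨ l = 1) := by
    rcases lt_or_gt_of_ne ha.ne with h | h
    · exact ⟨0, 1, le_rfl, Or.inl ⟨rfl, h⟩, Or.inr rfl⟩
    · exact ⟨1, 0, le_rfl, Or.inr rfl, Or.inl ⟨rfl, hP.lt_of_path hG ha hb hca hqb h⟩⟩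
  obtain ⟨u, hu, hua, hUfar⟩ := exists_far_of_isGreatest_centerOf hG hU hc ha hk
  obtain ⟨v, hv, hvb, hWfar⟩ := exists_far_of_isGreatest_centerOf hG hW hq hb hl
  obtain ⟨p, hpU, hpW⟩ := hUW
  have h1 := hG.connected.dist_triangle (u := c) (v := p) (w := q)
  have h2 := hUfar p hpU
  have h3 := hWfar p hpW
  -- the path from `u` to `v` passes through `c` and `q`
  have huq := dist_eq_of_separated hG ha hua (x := q) (by rw [G.dist_comm, hca, G.dist_comm])
  have hub : G.dist u q = G.dist u b + 1 := by
    have h4 := hG.connected.dist_triangle (u := u) (v := c) (w := b)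
    rw [G.dist_comm (u := c) (v := b)] at h4
    rw [G.dist_comm (u := q) (v := c)] at hqb
    rcases hG.dist_eq_dist_add_one_of_adj u hb with h | h <;> omega
  have huv := dist_eq_of_separated hG hb.symm (u := u) (x := v) hub hvb
  have h5 := hd u hu v hv
  rw [G.dist_comm (u := q) (v := p)] at h3
  rw [G.dist_comm (u := q) (v := v)] at huv
  omega

end EliminationOrder

/-! ### Safe areas -/

section SafeAreaOfTree

variable {P : Type v} [Fintype P] {V : Type u} {G : SimpleGraph V} {f : ℕ}

theorem isMonoConvex_safeArea (m : P → Option V) : IsMonoConvex G (safeArea G f m) := by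
  intro a ha b hb p hp hc w hw
  simp only [safeArea, Set.mem_iInter] at *
  exact fun J hJ => isMonoConvex_monoHull G _ a (ha J hJ) b (hb J hJ) p hp hc w hw

/-- Some set of all but `f` of the received values avoids the at most `f` faulty processors. -/
theorem safeArea_subset_monoHull {m : P → Option V} {F : Finset P} (hF : F.card ≤ f) {X : Set V}
    (hX : ∀ j ∉ F, ∀ a, m j = some a → a ∈ X) : safeArea G f m ⊆ monoHull G X := by
  classical
  have hcard : (received m).card - f ≤ (received m \ F).card :=
    (Nat.sub_le_sub_left hF _).trans (Finset.le_card_sdiff _ _)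
  obtain ⟨J, hJ, hJc⟩ := Finset.exists_subset_card_eq hcard
  refine (Set.biInter_subset_of_mem (Finset.mem_coe.2 (Finset.mem_powersetCard.2
    ⟨hJ.trans Finset.sdiff_subset, hJc⟩))).trans (monoHull_subset (isMonoConvex_monoHull G X) ?_)
  rintro a ⟨j, hj, hja⟩
  exact subset_monoHull G X (hX j (Finset.mem_sdiff.1 (hJ hj)).2 a hja)

/-- Omitting at most `f` senders on either side leaves a common one among more than `2 * f`. -/
theorem valuesOf_inter_nonempty {m m' : P → Option V}
    (hcard : 2 * f < (Finset.univ.filter fun k => (m k).isSome ∧ (m' k).isSome).card)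
    (hagree : ∀ k a b, m k = some a → m' k = some b → a = b) {J J' : Finset P}
    (hJ : J ∈ (received m).powersetCard ((received m).card - f))
    (hJ' : J' ∈ (received m').powersetCard ((received m').card - f)) :
    (valuesOf m J ∩ valuesOf m' J').Nonempty := by
  classical
  obtain ⟨hJs, hJc⟩ := Finset.mem_powersetCard.1 hJ
  obtain ⟨hJs', hJc'⟩ := Finset.mem_powersetCard.1 hJ'
  by_contra hcon
  have hcover : (Finset.univ.filter fun k => (m k).isSome ∧ (m' k).isSome) ⊆
      (received m \ J) ∪ (received m' \ J') := by
    intro k hk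
    obtain ⟨h, h'⟩ := (Finset.mem_filter.1 hk).2
    simp only [Finset.mem_union, Finset.mem_sdiff, received, Finset.mem_filter, Finset.mem_univ,
      true_and, h, h']
    by_contra! hkJ
    obtain ⟨a, ha⟩ := Option.isSome_iff_exists.1 h
    obtain ⟨b, hb⟩ := Option.isSome_iff_exists.1 h'
    exact hcon ⟨a, ⟨k, hkJ.1, ha⟩, ⟨k, hkJ.2, hagree k a b ha hb ▸ hb⟩⟩
  have h1 := Finset.card_le_card hcover
  have h2 := Finset.card_union_le (received m \ J) (received m' \ J')
  rw [Finset.card_sdiff_of_subset hJs, Finset.card_sdiff_of_subset hJs'] at h2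
  omega

theorem safeArea_inter_nonempty (hG : G.IsTree) [Finite V] {m m' : P → Option V}
    (hcard : 2 * f < (Finset.univ.filter fun k => (m k).isSome ∧ (m' k).isSome).card)
    (hagree : ∀ k a b, m k = some a → m' k = some b → a = b) :
    (safeArea G f m ∩ safeArea G f m').Nonempty := by
  let S (m : P → Option V) : Set (Set V) := (fun J => monoHull G (valuesOf m J)) ''
    {J | J ∈ (received m).powersetCard ((received m).card - f)}
  have hconv : ∀ U ∈ S m ∪ S m', IsMonoConvex G U := by
    rintro _ (⟨J, -, rfl⟩ | ⟨J, -, rfl⟩) <;> exact isMonoConvex_monoHull G _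
  have meet : ∀ m₁ m₂ : P → Option V,
      2 * f < (Finset.univ.filter fun k => (m₁ k).isSome ∧ (m₂ k).isSome).card →
      (∀ k a b, m₁ k = some a → m₂ k = some b → a = b) →
      ∀ U ∈ S m₁, ∀ W ∈ S m₂, (U ∩ W).Nonempty := by
    rintro m₁ m₂ h h' _ ⟨J, hJ, rfl⟩ _ ⟨J', hJ', rfl⟩
    exact (valuesOf_inter_nonempty h h' hJ hJ').mono
      (Set.inter_subset_inter (subset_monoHull G _) (subset_monoHull G _))
  have hm : 2 * f < (Finset.univ.filter fun k => (m k).isSome ∧ (m k).isSome).card :=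
    hcard.trans_le (Finset.card_le_card fun k => by simp +contextual)
  have hm' : 2 * f < (Finset.univ.filter fun k => (m' k).isSome ∧ (m' k).isSome).card :=
    hcard.trans_le (Finset.card_le_card fun k => by simp +contextual)
  have self : ∀ (m : P → Option V) k a b, m k = some a → m k = some b → a = b :=
    fun m k a b ha hb => Option.some_injective _ (ha.symm.trans hb)
  obtain ⟨g, hg⟩ := exists_mem_of_pairwise_inter hG hconv <| by
    rintro U (hU | hU) W (hW | hW)
    · exact meet m m hm (self m) U hU W hW
    · exact meet m m' hcard hagree U hU W hW
    · rw [Set.inter_comm]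
      exact meet m m' hcard hagree W hW U hU
    · exact meet m' m' hm' (self m') U hU W hW
  refine ⟨g, ?_, ?_⟩ <;> simp only [safeArea, Set.mem_iInter] <;> intro J hJ
  · exact hg _ (Or.inl ⟨J, hJ, rfl⟩)
  · exact hg _ (Or.inr ⟨J, hJ, rfl⟩)

theorem isGreatest_maxCenter [Finite V] [LinearOrder V] (a : V) {K : Set V} (hK : K.Nonempty) :
    IsGreatest (centerOf G K) (maxCenter G a K) := by
  rw [maxCenter, dif_pos (exists_isGreatest_centerOf hK)]
  exact (exists_isGreatest_centerOf hK).choose_spec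

theorem centerOf_subset (K : Set V) : centerOf G K ⊆ K := by
  rintro _ ⟨c, -, rfl⟩
  exact c.2

end SafeAreaOfTree

/-! ### Executions of the safe-area algorithm -/

section Execution

variable {P : Type v} [Fintype P] {V : Type u} [Finite V] [LinearOrder V] {G : SimpleGraph V}
  {f : ℕ} {F : Finset P} {x : P → V} {M : ℕ → P → P → Option V}

/-- The values of the correct processors at the start of round `t`. -/
def correctValues (G : SimpleGraph V) (f : ℕ) (F : Finset P) (x : P → V)
    (M : ℕ → P → P → Option V) (t : ℕ) : Set V :=
  (safeAreaAlgorithm P G f).state x M t '' {i | i ∉ F}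

/-- In one round the values of the correct processors stay in their hull, and the diameter `d` of
that hull drops to `(d + 1) / 2` or less. -/
theorem correctValues_succ (hG : G.IsTree) (hP : IsPerfectEliminationOrder G)
    (hn : 3 * f < Fintype.card P) (hM : (safeAreaAlgorithm P G f).IsExecution f F x M) (t : ℕ) :
    correctValues G f F x M (t + 1) ⊆ monoHull G (correctValues G f F x M t) ∧
    ∀ d, (∀ a ∈ correctValues G f F x M t, ∀ b ∈ correctValues G f F x M t, G.dist a b ≤ d) →
      ∀ a ∈ correctValues G f F x M (t + 1), ∀ b ∈ correctValues G f F x M (t + 1),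
        2 * G.dist a b ≤ d + 1 := by
  have hinter : ∀ i ∉ F, ∀ j ∉ F,
      (safeArea G f (M t i) ∩ safeArea G f (M t j)).Nonempty := by
    intro i hi j hj
    refine safeArea_inter_nonempty hG (lt_of_lt_of_le (by omega) (hM.common t i hi j hj)) ?_
    intro k a b ha hb
    by_cases hk : k ∈ F
    · exact hM.consistent t i hi j hj k hk a b ha hb
    · exact (hM.correct_sender t i hi k hk a ha).trans (hM.correct_sender t j hj k hk b hb).symm
  have hsub : ∀ i ∉ F, safeArea G f (M t i) ⊆ monoHull G (correctValues G f F x M t) :=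
    fun i hi => safeArea_subset_monoHull hM.card_faulty_le fun j hj a ha =>
      ⟨j, hj, (hM.correct_sender t i hi j hj a ha).symm⟩
  have hgreatest : ∀ i ∉ F, IsGreatest (centerOf G (safeArea G f (M t i)))
      ((safeAreaAlgorithm P G f).state x M (t + 1) i) :=
    fun i hi => isGreatest_maxCenter _ ((hinter i hi i hi).mono Set.inter_subset_left)
  constructor
  · rintro _ ⟨i, hi, rfl⟩
    exact hsub i hi (centerOf_subset _ (hgreatest i hi).1)
  · rintro d hd _ ⟨i, hi, rfl⟩ _ ⟨j, hj, rfl⟩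
    exact two_mul_dist_le_of_isGreatest_centerOf hG hP (isMonoConvex_safeArea _)
      (isMonoConvex_safeArea _) (hinter i hi j hj)
      (fun a ha b hb => dist_le_of_mem_monoHull hG hd a (hsub i hi ha) b (hsub j hj hb))
      (hgreatest i hi) (hgreatest j hj)

theorem correctValues_subset_monoHull (hG : G.IsTree) (hP : IsPerfectEliminationOrder G)
    (hn : 3 * f < Fintype.card P) (hM : (safeAreaAlgorithm P G f).IsExecution f F x M) (t : ℕ) :
    correctValues G f F x M t ⊆ monoHull G (x '' {j | j ∉ F}) := by
  induction t with
  | zero => exact subset_monoHull G _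
  | succ t ih =>
    exact (correctValues_succ hG hP hn hM t).1.trans (monoHull_subset (isMonoConvex_monoHull G _) ih)

/-- Iterating `d ↦ (d + 1) / 2` halves `d - 1` in every round. -/
theorem exists_dist_correctValues_le (hG : G.IsTree) (hP : IsPerfectEliminationOrder G)
    (hn : 3 * f < Fintype.card P) (hM : (safeAreaAlgorithm P G f).IsExecution f F x M) (t : ℕ) :
    ∃ d, (∀ a ∈ correctValues G f F x M t, ∀ b ∈ correctValues G f F x M t, G.dist a b ≤ d) ∧
      2 ^ t * d < G.diam + 2 ^ t := by
  induction t with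
  | zero =>
    have : Nonempty V := hG.connected.nonempty
    exact ⟨G.diam, fun a _ b _ => dist_le_diam (connected_iff_ediam_ne_top.1 hG.connected),
      by simp⟩
  | succ t ih =>
    obtain ⟨d, hd, hlt⟩ := ih
    refine ⟨(d + 1) / 2, fun a ha b hb => ?_, ?_⟩
    · have := (correctValues_succ hG hP hn hM t).2 d hd a ha b hb
      omega
    · calc 2 ^ (t + 1) * ((d + 1) / 2) = 2 ^ t * (2 * ((d + 1) / 2)) := by ring
        _ ≤ 2 ^ t * (d + 1) := Nat.mul_le_mul_left _ (Nat.mul_div_le _ _)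
        _ = 2 ^ t * d + 2 ^ t := by ring
        _ < G.diam + 2 ^ t + 2 ^ t := by omega
        _ = G.diam + 2 ^ (t + 1) := by ring

theorem safeAreaAlgorithm_solves (hG : G.IsTree) (hP : IsPerfectEliminationOrder G)
    (hn : 3 * f < Fintype.card P) {T : ℕ} (hT : G.diam < 2 ^ T) :
    (safeAreaAlgorithm P G f).SolvesApproxAgreement G f T := by
  intro F x M hM
  refine ⟨fun i hi => correctValues_subset_monoHull hG hP hn hM T ⟨i, hi, rfl⟩,
    fun i hi j hj => ?_⟩
  obtain ⟨d, hd, hlt⟩ := exists_dist_correctValues_le hG hP hn hM T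
  refine (hd _ ⟨i, hi, rfl⟩ _ ⟨j, hj, rfl⟩).trans ?_
  have : 2 ^ T * d < 2 ^ T * 2 := by omega
  exact Nat.lt_succ_iff.1 (Nat.lt_of_mul_lt_mul_left this)

end Execution

theorem lt_two_pow_of_floor_logb_lt {D T : ℕ} (h : ⌊Real.logb 2 (D : ℝ)⌋₊ + 1 ≤ T) :
    D < 2 ^ T := by
  rcases Nat.eq_zero_or_pos D with rfl | hD
  · positivity
  have h1 : Real.logb 2 (D : ℝ) < T :=
    (Nat.lt_floor_add_one _).trans_le (by exact_mod_cast h)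
  rw [Real.logb_lt_iff_lt_rpow one_lt_two (by exact_mod_cast hD), Real.rpow_natCast] at h1
  exact_mod_cast h1

end ByzantineAgreement

theorem mainTheorem6 {V : Type u} [Finite V] [Nontrivial V] (G : SimpleGraph V) (hG : G.IsTree)
    (n f : ℕ) (hn : 3 * f < n) :
    (∃ A : ByzantineAgreement.RoundAlgorithm (Fin n) V,
      A.SolvesApproxAgreement G f (⌊Real.logb 2 (G.diam : ℝ)⌋₊ + 1)) ∧
    (∃ _ : LinearOrder V, ByzantineAgreement.IsPerfectEliminationOrder G) ∧
    (∀ [LinearOrder V], ByzantineAgreement.IsPerfectEliminationOrder G →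
      ∀ T : ℕ, ⌊Real.logb 2 (G.diam : ℝ)⌋₊ + 1 ≤ T →
        (ByzantineAgreement.safeAreaAlgorithm (Fin n) G f).SolvesApproxAgreement G f T) := by
  have hn' : 3 * f < Fintype.card (Fin n) := by rwa [Fintype.card_fin]
  have hPEO := ByzantineAgreement.exists_isPerfectEliminationOrder hG
  refine ⟨?_, hPEO, fun hP T hT => ByzantineAgreement.safeAreaAlgorithm_solves hG hP hn'
    (ByzantineAgreement.lt_two_pow_of_floor_logb_lt hT)⟩
  obtain ⟨_, hP⟩ := hPEO
  exact ⟨_, ByzantineAgreement.safeAreaAlgorithm_solves hG hP hn'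
    (ByzantineAgreement.lt_two_pow_of_floor_logb_lt le_rfl)⟩
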